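/- Let $k$ be a field of characteristic different from $2$, $3$ and $5$, and let $A$ be a commutative (not necessarily associative) $k$-algebra with multiplicative identity. Suppose that $A$ is metrized, i.e., that there is a nondegenerate symmetric $k$-bilinear form $\tau$ on $A$ that is associative: $\tau(ab,c)=\tau(a,bc)$ for all $a,b,c\in A$. Suppose further that $A$ satisfies a polynomial identity of degree $\le 4$ that is not implied by commutativity; that is, there is an element $f$ of the free nonassociative $k$-algebra on countably many variables, all of whose monomials have degree at most $4$, such that every substitution of elements of $A$ for the variables of $f$ gives $0$, while $f$ does not vanish identically on every commutative nonassociative $k$-algebra. Then $A$ satisfies the Jordan identity $$x(x^2y)=x^2(xy)\qquad\text{for all } x,y\in A,$$ and $A$ is power-associative, i.e., for every $a\in A$ the subalgebra of $A$ generated by $a$ is associative. -/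

import Mathlib

universe u v

namespace MetrizedAlg

/-- A nonassociative polynomial over `k` in the variables `x₀, x₁, x₂, …`, i.e. a `k`-linear
combination of nonassociative words. -/
abbrev NAPoly (k : Type u) [Field k] : Type u := FreeNonUnitalNonAssocAlgebra k ℕ

section
variable {k : Type u} [Field k]

/-- `f` has degree at most `n`: every word that occurs in `f` with a nonzero coefficient has at
most `n` letters (counted with multiplicity). -/
def DegreeLE (f : NAPoly k) (n : ℕ) : Prop :=
  ∀ w ∈ f.coeff.support, FreeMagma.length w ≤ n

/-- The algebra `A` satisfies the identity `f = 0`: every substitution of elements of `A` for the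
variables sends `f` to `0`. -/
def Satisfies (A : Type v) [NonUnitalNonAssocRing A] [Module k A] [IsScalarTower k A A]
    [SMulCommClass k A A] (f : NAPoly k) : Prop :=
  ∀ s : ℕ → A, FreeNonUnitalNonAssocAlgebra.lift k s f = 0

/-- The identity `f = 0` is implied by commutativity: all commutative `k`-algebras satisfy it.
The universe of `k` is large enough, since the free commutative nonassociative `k`-algebra in
countably many variables lives there. -/
def ImpliedByCommutativity (f : NAPoly k) : Prop :=
  ∀ (B : Type u) [NonUnitalNonAssocCommRing B] [Module k B] [IsScalarTower k B B]
    [SMulCommClass k B B], Satisfies B f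

end

/-- `A` is metrized: it carries a nondegenerate symmetric bilinear form that is associative. -/
def IsMetrized (k : Type u) [Field k] (A : Type v) [NonUnitalNonAssocRing A] [Module k A] : Prop :=
  ∃ τ : LinearMap.BilinForm k A,
    τ.IsSymm ∧ τ.Nondegenerate ∧ ∀ a b c : A, τ (a * b) c = τ a (b * c)

/-- `A` is power-associative: the subalgebra generated by any one element is associative. -/
def IsPowerAssociative (k : Type u) [Field k] (A : Type v) [NonUnitalNonAssocRing A] [Module k A]
    [IsScalarTower k A A] [SMulCommClass k A A] : Prop :=
  ∀ a : A, ∀ x ∈ NonUnitalAlgebra.adjoin k {a}, ∀ y ∈ NonUnitalAlgebra.adjoin k {a},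
    ∀ z ∈ NonUnitalAlgebra.adjoin k {a}, x * y * z = x * (y * z)

end MetrizedAlg

/-! In a commutative algebra where 2 is invertible, the Jordan identity implies power-associativity,
so only the Jordan identity needs proof. Suppose it fails; then `A` is not associative either. The
aim is to show that every identity of degree at most four on `A` follows from commutativity.

Scaling the variables splits the identity into homogeneous parts, and polarization turns these into
multilinear identities whose coefficients are sums over the symmetries of commutative words
(`coeff_two`, `coeff_three`, `coeff_four`). If all these sums vanish, the polynomial vanishes on
every commutative algebra. Degrees one and two are settled by the unit, degree three by
non-associativity (`degree_three_coeffs`).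

In degree four, pairing with a fifth variable through `τ` gives a relation between fifteen forms `τ
((p * q) * r) (s * t)`: a middle variable `r` and a pairing of the other four. They correspond to
the edges {pq}–{st} of the Petersen graph on the ten pairs of variables. Putting 1 for one variable
leaves three forms `τ (p * q) (r * s)`, independent by the degree three case. The resulting
equations say that the coefficients on each edge and its four neighbours sum to zero. As 3 is
invertible, the coefficient then depends only on the middle variable. Failure of the Jordan identity
makes the five remaining values equal; their sum is zero, and 5 is invertible
(`five_form_relation`). -/

namespace MetrizedAlg

/-! ### Jordan algebras are power-associative -/

section Jordan

variable {A : Type v} [NonAssocCommRing A]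

/-- The right-normed powers `a ^ n = a * (a * (⋯ * 1))`. -/
def npow (a : A) : ℕ → A
  | 0 => 1
  | n + 1 => a * npow a n

theorem jordan_linearized (h2 : ∀ z : A, 2 • z = 0 → z = 0)
    (hJ : ∀ x y : A, x * ((x * x) * y) = (x * x) * (x * y)) (a b c d : A) :
    a * ((b * c) * d) - (b * c) * (a * d) + (b * ((c * a) * d) - (c * a) * (b * d))
      + (c * ((a * b) * d) - (a * b) * (c * d)) = 0 := by
  have : IsCommJordan A := ⟨fun x y => by
    rw [mul_comm (x * y), ← hJ, mul_comm y (x * x)]⟩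
  have h := two_nsmul_lie_lmul_lmul_add_add_eq_zero a b c
  apply h2
  exact DFunLike.congr_fun h d

/-- The operator of multiplication by `(b * c) * a` in a Jordan algebra. -/
theorem jordan_mul_expand (h2 : ∀ z : A, 2 • z = 0 → z = 0)
    (hJ : ∀ x y : A, x * ((x * x) * y) = (x * x) * (x * y)) (a b c d : A) :
    (a * (b * c)) * d = (b * c) * (a * d) + (c * d) * (b * a) + (b * d) * (c * a)
      - b * (a * (c * d)) - c * (a * (b * d)) := by
  have e := jordan_linearized h2 hJ d b c a
  rw [mul_comm d ((b * c) * a), mul_comm (b * c) a, mul_comm d a, mul_comm (c * d) a,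
    mul_comm d b, mul_comm (b * d) a] at e
  rw [← sub_eq_zero, ← e]
  abel

/-- By `jordan_mul_expand`, multiplication by `npow a (n + 2)` is a polynomial in the
multiplications by `a`, `a * a`, `npow a n` and `npow a (n + 1)`. Each of these commutes with
multiplication by `a`, by induction or by the Jordan identity. -/
theorem npow_mul_comm_left (h2 : ∀ z : A, 2 • z = 0 → z = 0)
    (hJ : ∀ x y : A, x * ((x * x) * y) = (x * x) * (x * y)) (a : A) (n : ℕ) :
    ∀ d, a * (npow a n * d) = npow a n * (a * d) := by
  induction n using Nat.strong_induction_on with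
  | _ n ih =>
    match n, ih with
    | 0, _ => intro d; simp [npow]
    | 1, _ => intro d; simp [npow]
    | n + 2, ih =>
      have h0 := ih n (by omega)
      have h1 := ih (n + 1) (by omega)
      have key : ∀ d, npow a (n + 2) * d = (a * npow a n) * (a * d) + (npow a n * d) * (a * a)
          + (a * d) * (npow a n * a) - a * (a * (npow a n * d)) - npow a n * (a * (a * d)) :=
        fun d => jordan_mul_expand h2 hJ a a (npow a n) d
      intro d
      have k1 := key d
      have k2 := key (a * d)
      have h1' : ∀ d, a * ((a * npow a n) * d) = (a * npow a n) * (a * d) := h1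
      rw [k1, k2, mul_comm (npow a n * d), mul_comm (a * d), mul_comm (npow a n) a,
        mul_comm (npow a n * (a * d)), mul_comm (a * (a * d))]
      simp only [mul_add, mul_sub, h1', h0, hJ]

theorem npow_mul_npow (h2 : ∀ z : A, 2 • z = 0 → z = 0)
    (hJ : ∀ x y : A, x * ((x * x) * y) = (x * x) * (x * y)) (a : A) (m n : ℕ) :
    npow a m * npow a n = npow a (m + n) := by
  induction n with
  | zero => simp [npow]
  | succ n ih =>
    rw [npow, ← npow_mul_comm_left h2 hJ, ih]
    rfl

theorem isPowerAssociative_of_jordan {k : Type u} [Field k] [Module k A] [IsScalarTower k A A]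
    [SMulCommClass k A A] (hk : (2 : k) ≠ 0)
    (hJ : ∀ x y : A, x * ((x * x) * y) = (x * x) * (x * y)) : IsPowerAssociative k A := by
  have h2 : ∀ z : A, 2 • z = 0 → z = 0 := fun z hz => by
    rw [← Nat.cast_smul_eq_nsmul k] at hz
    exact (smul_eq_zero.1 hz).resolve_left (by exact_mod_cast hk)
  intro a
  set S := Submodule.span k (Set.range (npow a))
  have hmul : ∀ x ∈ S, ∀ y ∈ S, x * y ∈ S := by
    intro x hx y hy
    induction hx using Submodule.span_induction with
    | zero => simp
    | add x x' _ _ h h' => rw [add_mul]; exact S.add_mem h h'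
    | smul r x _ h => rw [smul_mul_assoc]; exact S.smul_mem r h
    | mem x hx =>
      obtain ⟨m, rfl⟩ := hx
      induction hy using Submodule.span_induction with
      | zero => simp
      | add x x' _ _ h h' => rw [mul_add]; exact S.add_mem h h'
      | smul r x _ h => rw [mul_smul_comm]; exact S.smul_mem r h
      | mem y hy =>
        obtain ⟨n, rfl⟩ := hy
        rw [npow_mul_npow h2 hJ]
        exact Submodule.subset_span ⟨_, rfl⟩
  have hle : ∀ x ∈ NonUnitalAlgebra.adjoin k {a}, x ∈ S := by
    intro x hx
    induction hx using NonUnitalAlgebra.adjoin_induction with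
    | mem x hx =>
      rw [Set.mem_singleton_iff.1 hx]
      exact Submodule.subset_span ⟨1, by simp [npow]⟩
    | zero => exact S.zero_mem
    | add x y _ _ h h' => exact S.add_mem h h'
    | mul x y _ _ h h' => exact hmul x h y h'
    | smul r x _ h => exact S.smul_mem r h
  suffices h : ∀ x ∈ S, ∀ y ∈ S, ∀ z ∈ S, x * y * z = x * (y * z) from
    fun x hx y hy z hz => h x (hle x hx) y (hle y hy) z (hle z hz)
  intro x hx y hy z hz
  induction hx using Submodule.span_induction with
  | zero => simp
  | add x x' _ _ h h' => simp only [add_mul, h, h']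
  | smul r x _ h => simp only [smul_mul_assoc, h]
  | mem x hx =>
    obtain ⟨l, rfl⟩ := hx
    induction hy using Submodule.span_induction with
    | zero => simp
    | add x x' _ _ h h' => simp only [add_mul, mul_add, h, h']
    | smul r x _ h => simp only [smul_mul_assoc, mul_smul_comm, h]
    | mem y hy =>
      obtain ⟨m, rfl⟩ := hy
      induction hz using Submodule.span_induction with
      | zero => simp
      | add x x' _ _ h h' => simp only [mul_add, h, h']
      | smul r x _ h => simp only [mul_smul_comm, h]
      | mem z hz =>
        obtain ⟨n, rfl⟩ := hz
        simp only [npow_mul_npow h2 hJ, add_assoc]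

end Jordan

/-! ### The linear relation between fifteen quintilinear forms -/

section FiveForms

variable {k : Type u} [Field k] {A : Type v}

set_option linter.unusedSimpArgs false in
/-- A nontrivial multilinear identity of degree four in a metrized algebra is a linear relation
between the fifteen forms `T p q r s t = τ ((p * q) * r) (s * t)`. If the forms
`P p q r s = τ (p * q) (r * s)` are linearly independent, substituting `1` for each variable shows
that such a relation is either trivial or forces the Jordan identity. -/
theorem five_form_relation [One A] (h3 : (3 : k) ≠ 0) (h5 : (5 : k) ≠ 0)
    (T : A → A → A → A → A → k) (P : A → A → A → A → k)
    (T_swap₁ : ∀ p q r s t, T p q r s t = T q p r s t)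
    (T_swap₂ : ∀ p q r s t, T p q r s t = T p q r t s)
    (T_swap₃ : ∀ p q r s t, T p q r s t = T s t r p q)
    (P₁ : ∀ p q r s, P p q r s = P q p r s) (P₂ : ∀ p q r s, P p q r s = P p q s r)
    (P₃ : ∀ p q r s, P p q r s = P r s p q)
    (T₁ : ∀ q r s t, T 1 q r s t = P q r s t) (T₂ : ∀ p r s t, T p 1 r s t = P p r s t)
    (T₃ : ∀ p q s t, T p q 1 s t = P p q s t) (T₄ : ∀ p q r t, T p q r 1 t = P p q r t)
    (T₅ : ∀ p q r s, T p q r s 1 = P p q r s)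
    (hP : ∀ α β γ : k, (∀ p q r s, α * P p q r s + β * P p r q s + γ * P p s q r = 0) →
      α = 0 ∧ β = 0 ∧ γ = 0)
    (hT : ¬ ∀ X Y V, T X X Y X V = T X X V X Y)
    {a12 a13 a14 a21 a23 a24 a31 a32 a34 a41 a42 a43 b12 b13 b14 : k}
    (H : ∀ x y z w v, a12 * T z w y x v + a13 * T y w z x v + a14 * T y z w x v + a21 * T z w x y v
        + a23 * T x w z y v + a24 * T x z w y v + a31 * T y w x z v + a32 * T x w y z v
        + a34 * T x y w z v + a41 * T y z x w v + a42 * T x z y w v + a43 * T x y z w v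
        + b12 * T x y v z w + b13 * T x z v y w + b14 * T x w v y z = 0) :
    a43 = 0 ∧ b12 = 0 := by
  -- With 1 for `x`, each pairing of the other four variables collects five coefficients: one form
  -- with `x` in the middle and four with `x` inside a pair. The other four variables are treated
  -- alike.
  obtain ⟨ex1, ex2, ex3⟩ := hP (a41 + a43 + a42 + b14 + a14) (a31 + a34 + a32 + b13 + a13)
      (a21 + b12 + a12 + a24 + a23) fun p q r s => by
    have h := H 1 p q r s
    simp only [T₁, T₂, T₃, T₄, T₅, P₁, P₂, P₃] at h ⊢
    linear_combination h
  obtain ⟨ey1, ey2, ey3⟩ := hP (a42 + a43 + a41 + b13 + a24) (a32 + a34 + a31 + b14 + a23)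
      (a12 + b12 + a21 + a14 + a13) fun p q r s => by
    have h := H p 1 q r s
    simp only [T₁, T₂, T₃, T₄, T₅, P₁, P₂, P₃] at h ⊢
    linear_combination h
  obtain ⟨ez1, ez2, ez3⟩ := hP (a43 + a42 + a41 + b12 + a34) (a23 + a24 + a21 + b14 + a32)
      (a13 + b13 + a31 + a14 + a12) fun p q r s => by
    have h := H p q 1 r s
    simp only [T₁, T₂, T₃, T₄, T₅, P₁, P₂, P₃] at h ⊢
    linear_combination h
  obtain ⟨ew1, ew2, ew3⟩ := hP (a34 + a32 + a31 + b12 + a43) (a24 + a23 + a21 + b13 + a42)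
      (a14 + b14 + a41 + a13 + a12) fun p q r s => by
    have h := H p q r 1 s
    simp only [T₁, T₂, T₃, T₄, T₅, P₁, P₂, P₃] at h ⊢
    linear_combination h
  obtain ⟨ev1, ev2, ev3⟩ := hP (b12 + a12 + a21 + a34 + a43) (b13 + a13 + a31 + a24 + a42)
      (b14 + a14 + a41 + a23 + a32) fun p q r s => by
    have h := H p q r s 1
    simp only [T₁, T₂, T₃, T₄, T₅, P₁, P₂, P₃] at h ⊢
    linear_combination h
  -- The fifteen equations are now solved. Each combination isolates three times the difference of
  -- two coefficients whose forms have the same middle variable.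
  have ra23 : a23 = a13 := mul_left_cancel₀ h3 <| by
    linear_combination - ez2 + ew2 + ex3 + ev3 + ey2 + ez3 - ev2 - ex2 - ew3 - ey3
  have ra24 : a24 = a14 := mul_left_cancel₀ h3 <| by
    linear_combination - ew2 + ez2 + ex3 + ev2 + ey1 + ew3 - ev3 - ex1 - ez3 - ey3
  have ra31 : a31 = a21 := mul_left_cancel₀ h3 <| by
    linear_combination - ex2 + ew1 + ey2 + ev2 + ez3 + ex3 - ev1 - ey3 - ew2 - ez2
  have ra32 : a32 = a12 := mul_left_cancel₀ h3 <| by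
    linear_combination - ey2 + ew1 + ex2 + ev3 + ez2 + ey3 - ev1 - ex3 - ew3 - ez3
  have ra34 : a34 = a14 := mul_left_cancel₀ h3 <| by
    linear_combination - ew1 + ey2 + ex2 + ev1 + ez1 + ew3 - ev3 - ex1 - ez3 - ey3
  have ra41 : a41 = a21 := mul_left_cancel₀ h3 <| by
    linear_combination - ex1 + ez1 + ey1 + ev3 + ew3 + ex3 - ev1 - ey3 - ew2 - ez2
  have ra42 : a42 = a12 := mul_left_cancel₀ h3 <| by
    linear_combination - ey1 + ez1 + ex1 + ev2 + ew2 + ey3 - ev1 - ex3 - ew3 - ez3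
  have ra43 : a43 = a13 := mul_left_cancel₀ h3 <| by
    linear_combination - ez1 + ey1 + ex1 + ev1 + ew1 + ez3 - ev2 - ex2 - ew3 - ey3
  have rb13 : b13 = b12 := mul_left_cancel₀ h3 <| by
    linear_combination - ev2 + ez3 + ex2 + ew2 + ey1 + ev1 - ey3 - ex3 - ew1 - ez1
  have rb14 : b14 = b12 := mul_left_cancel₀ h3 <| by
    linear_combination - ev3 + ew3 + ex1 + ez2 + ey2 + ev1 - ey3 - ex3 - ew1 - ez1
  simp only [ra23, ra24, ra31, ra32, ra34, ra41, ra42, ra43, rb13, rb14] at H ex3 ⊢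
  push Not at hT
  obtain ⟨X, Y, V, hne⟩ := hT
  rw [← sub_ne_zero] at hne
  -- Three variables are set to `X`, the other two to `Y` and `V`. Forms with `X` in the middle
  -- contribute symmetrically in `Y` and `V`, so they cancel on exchanging these. What remains is
  -- three times the difference of two coefficients times the nonzero `hne`.
  have f1 : a21 = b12 := by
    have h := H Y X X X V
    have h' := H V X X X Y
    simp only [T_swap₁, T_swap₂, T_swap₃] at h h' hne
    refine sub_eq_zero.1 (mul_left_cancel₀ hne (mul_left_cancel₀ h3 ?_))
    linear_combination h - h'
  have f2 : a12 = b12 := by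
    have h := H X Y X X V
    have h' := H X V X X Y
    simp only [T_swap₁, T_swap₂, T_swap₃] at h h' hne
    refine sub_eq_zero.1 (mul_left_cancel₀ hne (mul_left_cancel₀ h3 ?_))
    linear_combination h - h'
  have f3 : a13 = b12 := by
    have h := H X X Y X V
    have h' := H X X V X Y
    simp only [T_swap₁, T_swap₂, T_swap₃] at h h' hne
    refine sub_eq_zero.1 (mul_left_cancel₀ hne (mul_left_cancel₀ h3 ?_))
    linear_combination h - h'
  have f4 : a14 = b12 := by
    have h := H X X X Y V
    have h' := H X X X V Y
    simp only [T_swap₁, T_swap₂, T_swap₃] at h h' hne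
    refine sub_eq_zero.1 (mul_left_cancel₀ hne (mul_left_cancel₀ h3 ?_))
    linear_combination h - h'
  -- `ex3` now says that the five coefficients, all equal, sum to zero.
  have hb : b12 = 0 := mul_left_cancel₀ h5 <| by
    linear_combination ex3 - f1 - f2 - f3 - f4
  exact ⟨f3.trans hb, hb⟩

end FiveForms

/-! ### Multilinear identities of degrees three and four -/

section Identities

variable {k : Type u} [Field k] {A : Type v} [NonAssocCommRing A] [Module k A]

theorem one_ne_zero_of_not_assoc (hA : ¬ ∀ x y z : A, x * y * z = x * (y * z)) : (1 : A) ≠ 0 := by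
  intro h
  have h0 : ∀ x : A, x = 0 := fun x => by rw [← mul_one x, h, mul_zero]
  exact hA fun x y z => (h0 _).trans (h0 _).symm

/-- Exchanging two variables and subtracting leaves a difference of coefficients times an
associator, so all three coefficients agree. At `x = y = z = 1` their sum vanishes. -/
theorem degree_three_coeffs (h3 : (3 : k) ≠ 0) (hA : ¬ ∀ x y z : A, x * y * z = x * (y * z))
    {α β γ : k}
    (h : ∀ x y z : A, α • ((x * y) * z) + β • ((x * z) * y) + γ • ((y * z) * x) = 0) :
    α = 0 ∧ β = 0 ∧ γ = 0 := by
  have h1 := one_ne_zero_of_not_assoc hA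
  have hsum : α + β + γ = 0 := by
    have := h 1 1 1
    simp only [mul_one, ← add_smul] at this
    exact (smul_eq_zero.1 this).resolve_right h1
  have hβγ : β = γ := by
    by_contra hne
    refine hA fun x y z => ?_
    have e : (β - γ) • ((x * y) * z - (z * y) * x) = 0 := by
      have e1 := h x z y
      have e2 := h z x y
      rw [mul_comm z x] at e2
      rw [← sub_eq_zero.2 (e1.trans e2.symm)]
      module
    rw [mul_comm x (y * z), mul_comm y z]
    exact sub_eq_zero.1 ((smul_eq_zero.1 e).resolve_left (sub_ne_zero.2 hne))
  have hαβ : α = β := by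
    by_contra hne
    refine hA fun x y z => ?_
    have e : (α - β) • ((y * x) * z - (y * z) * x) = 0 := by
      have e1 := h y x z
      have e2 := h y z x
      rw [mul_comm z x] at e2
      rw [← sub_eq_zero.2 (e1.trans e2.symm)]
      module
    rw [mul_comm x (y * z), mul_comm x y]
    exact sub_eq_zero.1 ((smul_eq_zero.1 e).resolve_left (sub_ne_zero.2 hne))
  subst hαβ hβγ
  have : α = 0 := mul_left_cancel₀ h3 (by linear_combination hsum)
  exact ⟨this, this, this⟩

theorem degree_four_coeffs (h3 : (3 : k) ≠ 0) (h5 : (5 : k) ≠ 0) (hτ : IsMetrized k A)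
    (hA : ¬ ∀ x y z : A, x * y * z = x * (y * z))
    (hJ : ¬ ∀ x y : A, x * ((x * x) * y) = (x * x) * (x * y))
    {a12 a13 a14 a21 a23 a24 a31 a32 a34 a41 a42 a43 b12 b13 b14 : k}
    (h : ∀ x y z w : A,
      a12 • (((z * w) * y) * x) + a13 • (((y * w) * z) * x) + a14 • (((y * z) * w) * x)
          + a21 • (((z * w) * x) * y) + a23 • (((x * w) * z) * y) + a24 • (((x * z) * w) * y)
          + a31 • (((y * w) * x) * z) + a32 • (((x * w) * y) * z) + a34 • (((x * y) * w) * z)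
          + a41 • (((y * z) * x) * w) + a42 • (((x * z) * y) * w) + a43 • (((x * y) * z) * w)
          + b12 • ((x * y) * (z * w)) + b13 • ((x * z) * (y * w))
          + b14 • ((x * w) * (y * z)) = 0) :
    a43 = 0 ∧ b12 = 0 := by
  obtain ⟨τ, hsymm, hnd, hass⟩ := hτ
  have hc : ∀ x y, τ x y = τ y x := fun x y => hsymm.eq x y
  have hz : ∀ x, (∀ y, τ x y = 0) → x = 0 := hnd.1
  have hT₃ : ∀ p q r s t, τ ((p * q) * r) (s * t) = τ ((s * t) * r) (p * q) := fun p q r s t => by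
    rw [hass, hc, mul_comm r]
  have hτ₁ : ∀ p q r s t, τ (((p * q) * r) * s) t = τ ((p * q) * r) (s * t) :=
    fun p q r s t => hass _ _ _
  have hτ₂ : ∀ p q r s t, τ ((p * q) * (r * s)) t = τ ((p * q) * t) (r * s) :=
    fun p q r s t => by rw [hass, mul_comm (r * s), ← hass]
  refine five_form_relation h3 h5 (fun p q r s t => τ ((p * q) * r) (s * t))
    (fun p q r s => τ (p * q) (r * s)) (fun p q r s t => by rw [mul_comm p q])
    (fun p q r s t => by rw [mul_comm s t]) hT₃
    (fun p q r s => by rw [mul_comm p q]) (fun p q r s => by rw [mul_comm r s])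
    (fun p q r s => hc _ _) (fun q r s t => by rw [one_mul]) (fun p r s t => by rw [mul_one])
    (fun p q s t => by rw [mul_one]) (fun p q r t => by rw [one_mul, hass])
    (fun p q r s => by rw [mul_one, hass]) ?_ ?_
    (H := ?_) (a12 := a12) (a13 := a13) (a14 := a14) (a21 := a21) (a23 := a23) (a24 := a24)
        (a31 := a31) (a32 := a32) (a34 := a34) (a41 := a41) (a42 := a42) (a43 := a43) (b12 := b12)
        (b13 := b13) (b14 := b14)
  · intro α β γ hαβγ
    refine degree_three_coeffs h3 hA fun x y z => hz _ fun w => ?_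
    have := hαβγ x y z w
    simp only [map_add, map_smul, LinearMap.add_apply, LinearMap.smul_apply, smul_eq_mul]
    rw [hass (x * y) z w, hass (x * z) y w, hass (y * z) x w, hc (y * z)]
    exact this
  -- Moving factors across `τ` shows that the symmetry in `Y` and `V` is the Jordan identity paired
  -- with `v`.
  · intro hT
    refine hJ fun x y => sub_eq_zero.1 (hz _ fun v => ?_)
    rw [map_sub, LinearMap.sub_apply, mul_comm x (x * x * y), hass (x * x * y), hT x y v,
      mul_comm (x * x) (x * y), hass (x * y), hc (x * y), sub_self]
  · intro x y z w v
    have := congrArg (fun a => τ a v) (h x y z w)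
    simp only [map_add, map_smul, LinearMap.add_apply, LinearMap.smul_apply, smul_eq_mul, map_zero,
      LinearMap.zero_apply, hτ₁, hτ₂] at this
    exact this

end Identities

/-! ### Polarization by inclusion–exclusion -/

section Polarization

variable {V W : Type*} [AddCommGroup V] [AddCommGroup W]

theorem polarization_two (M : V → V → W)
    (h₁ : ∀ a a' b, M (a + a') b = M a b + M a' b) (h₂ : ∀ a b b', M a (b + b') = M a b + M a b')
    (h : ∀ a, M a a = 0) (x y : V) : M x y + M y x = 0 := by
  have := h (x + y)
  simpa [h₁, h₂, h] using this

theorem polarization_three (M : V → V → V → W)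
    (h₁ : ∀ a a' b c, M (a + a') b c = M a b c + M a' b c)
    (h₂ : ∀ a b b' c, M a (b + b') c = M a b c + M a b' c)
    (h₃ : ∀ a b c c', M a b (c + c') = M a b c + M a b c')
    (h : ∀ a, M a a a = 0) (x y z : V) :
    M x y z + M x z y + M y x z + M y z x + M z x y + M z y x = 0 := by
  have e : M (x + y + z) (x + y + z) (x + y + z) - M (x + y) (x + y) (x + y)
      - M (x + z) (x + z) (x + z) - M (y + z) (y + z) (y + z) + M x x x + M y y y
          + M z z z = 0 := by
    simp only [h, sub_zero, add_zero]
  rw [← e]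
  simp only [h₁, h₂, h₃]
  abel

theorem polarization_four (M : V → V → V → V → W)
    (h₁ : ∀ a a' b c d, M (a + a') b c d = M a b c d + M a' b c d)
    (h₂ : ∀ a b b' c d, M a (b + b') c d = M a b c d + M a b' c d)
    (h₃ : ∀ a b c c' d, M a b (c + c') d = M a b c d + M a b c' d)
    (h₄ : ∀ a b c d d', M a b c (d + d') = M a b c d + M a b c d')
    (h : ∀ a, M a a a a = 0) (x y z w : V) :
    (M x y z w + M x z y w + M y x z w + M y z x w + M z x y w + M z y x w) +
    (M x y w z + M x z w y + M y x w z + M y z w x + M z x w y + M z y w x) +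
    (M x w y z + M x w z y + M y w x z + M y w z x + M z w x y + M z w y x) +
    (M w x y z + M w x z y + M w y x z + M w y z x + M w z x y + M w z y x) = 0 := by
  have e : M (x + y + z + w) (x + y + z + w) (x + y + z + w) (x + y + z + w) - M (x + y + z) (x + y
      + z) (x + y + z) (x + y + z) - M (x + y + w) (x + y + w) (x + y + w) (x + y + w) - M (x + z
      + w) (x + z + w) (x + z + w) (x + z + w) - M (y + z + w) (y + z + w) (y + z + w) (y + z + w)
      + M (x + y) (x + y) (x + y) (x + y) + M (x + z) (x + z) (x + z) (x + z) + M (x + w) (x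
      + w) (x + w) (x + w) + M (y + z) (y + z) (y + z) (y + z) + M (y + w) (y + w) (y + w) (y + w)
      + M (z + w) (z + w) (z + w) (z + w) - M x x x x - M y y y y - M z z z z - M w w w w = 0 := by
    simp only [h, sub_zero, add_zero]
  rw [← e]
  simp only [h₁, h₂, h₃, h₄]
  abel

end Polarization

/-! ### Linear combinations and symmetrization -/

section LinearCombination

variable {k : Type u} [Field k] {α : Type*} {B : Type v} [AddCommGroup B] [Module k B]

open Finsupp in
theorem linearCombination_symmetrize (c : α →₀ k) (m : α → B) (σ : α ≃ α)
    (hm : ∀ p, m (σ p) = m p) :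
    linearCombination k m (c + c.equivMapDomain σ.symm) = (2 : k) • linearCombination k m c := by
  have : m ∘ σ.symm = m := by
    funext p
    rw [Function.comp_apply, ← hm, Equiv.apply_symm_apply]
  rw [map_add, linearCombination_equivMapDomain, this, two_smul]

open Finsupp in
theorem linearCombination_fun_add (c : α →₀ k) {m m' n : α → B} (h : ∀ p, n p = m p + m' p) :
    linearCombination k n c = linearCombination k m c + linearCombination k m' c := by
  simp [h, linearCombination_apply, smul_add, Finsupp.sum_add]

open Finsupp in
theorem linearCombination_fun_smul (c : α →₀ k) (m : α → B) (t : k) :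
    linearCombination k (fun p => t • m p) c = t • linearCombination k m c := by
  simp [linearCombination_apply, Finsupp.smul_sum, smul_comm t]

end LinearCombination

/-! ### Shapes of words of length at most four -/

section Words

theorem length_eq_one {w : FreeMagma ℕ} (h : w.length = 1) : ∃ i, w = .of i := by
  cases w with
  | of i => exact ⟨i, rfl⟩
  | mul a b =>
    have := a.length_pos
    have := b.length_pos
    simp only [FreeMagma.length] at h
    omega

theorem length_eq_two {w : FreeMagma ℕ} (h : w.length = 2) :
    ∃ i j, w = .mul (.of i) (.of j) := by
  cases w with
  | of i => simp [FreeMagma.length] at h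
  | mul a b =>
    have := a.length_pos
    have := b.length_pos
    simp only [FreeMagma.length] at h
    obtain ⟨i, rfl⟩ := length_eq_one (w := a) (by omega)
    obtain ⟨j, rfl⟩ := length_eq_one (w := b) (by omega)
    exact ⟨i, j, rfl⟩

theorem length_eq_three {w : FreeMagma ℕ} (h : w.length = 3) :
    (∃ i j l, w = .mul (.mul (.of i) (.of j)) (.of l)) ∨
      ∃ i j l, w = .mul (.of l) (.mul (.of i) (.of j)) := by
  cases w with
  | of i => simp [FreeMagma.length] at h
  | mul a b =>
    have := a.length_pos
    have := b.length_pos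
    simp only [FreeMagma.length] at h
    obtain ha | ha : a.length = 2 ∨ a.length = 1 := by omega
    · obtain ⟨i, j, rfl⟩ := length_eq_two ha
      obtain ⟨l, rfl⟩ := length_eq_one (w := b) (by omega)
      exact .inl ⟨i, j, l, rfl⟩
    · obtain ⟨l, rfl⟩ := length_eq_one ha
      obtain ⟨i, j, rfl⟩ := length_eq_two (w := b) (by omega)
      exact .inr ⟨i, j, l, rfl⟩

theorem length_eq_four {w : FreeMagma ℕ} (h : w.length = 4) :
    (∃ i j l m, w = .mul (.mul (.mul (.of i) (.of j)) (.of l)) (.of m)) ∨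
    (∃ i j l m, w = .mul (.mul (.of l) (.mul (.of i) (.of j))) (.of m)) ∨
    (∃ i j l m, w = .mul (.of m) (.mul (.mul (.of i) (.of j)) (.of l))) ∨
    (∃ i j l m, w = .mul (.of m) (.mul (.of l) (.mul (.of i) (.of j)))) ∨
    ∃ i j l m, w = .mul (.mul (.of i) (.of j)) (.mul (.of l) (.of m)) := by
  cases w with
  | of i => simp [FreeMagma.length] at h
  | mul a b =>
    have := a.length_pos
    have := b.length_pos
    simp only [FreeMagma.length] at h
    obtain ha | ha | ha : a.length = 3 ∨ a.length = 1 ∨ a.length = 2 := by omega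
    · obtain ⟨m, rfl⟩ := length_eq_one (w := b) (by omega)
      obtain ⟨i, j, l, rfl⟩ | ⟨i, j, l, rfl⟩ := length_eq_three ha
      · exact .inl ⟨i, j, l, m, rfl⟩
      · exact .inr <| .inl ⟨i, j, l, m, rfl⟩
    · obtain ⟨m, rfl⟩ := length_eq_one ha
      obtain ⟨i, j, l, rfl⟩ | ⟨i, j, l, rfl⟩ := length_eq_three (w := b) (by omega)
      · exact .inr <| .inr <| .inl ⟨i, j, l, m, rfl⟩
      · exact .inr <| .inr <| .inr <| .inl ⟨i, j, l, m, rfl⟩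
    · obtain ⟨i, j, rfl⟩ := length_eq_two ha
      obtain ⟨l, m, rfl⟩ := length_eq_two (w := b) (by omega)
      exact .inr <| .inr <| .inr <| .inr ⟨i, j, l, m, rfl⟩

end Words

/-! ### Normal forms modulo commutativity -/

section NormalForm

variable {B : Type v} [NonUnitalNonAssocCommRing B]

/-- The words `x_i x_j`, as bilinear functions of two substitutions. -/
def word₂ (a b : ℕ → B) (p : ℕ × ℕ) : B := a p.1 * b p.2

/-- The words `(x_i x_j) x_l`, as trilinear functions of three substitutions. -/
def word₃ (a b c : ℕ → B) (p : ℕ × ℕ × ℕ) : B := (a p.1 * b p.2.1) * c p.2.2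

/-- The words `((x_i x_j) x_l) x_m`, as quadrilinear functions of four substitutions. -/
def word₄ (a b c d : ℕ → B) (p : ℕ × ℕ × ℕ × ℕ) : B :=
  ((a p.1 * b p.2.1) * c p.2.2.1) * d p.2.2.2

/-- The words `(x_i x_j) (x_l x_m)`, as quadrilinear functions of four substitutions. -/
def word₂₂ (a b c d : ℕ → B) (p : ℕ × ℕ × ℕ × ℕ) : B :=
  (a p.1 * b p.2.1) * (c p.2.2.1 * d p.2.2.2)

variable (k : Type u) [Field k]

/-- Coefficients of the words `x_i`, `x_i x_j`, `(x_i x_j) x_l`, `((x_i x_j) x_l) x_m` and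
`(x_i x_j) (x_l x_m)`, which modulo commutativity span the polynomials of degree at most four. -/
abbrev NormalForm : Type u :=
  (ℕ →₀ k) × (ℕ × ℕ →₀ k) × (ℕ × ℕ × ℕ →₀ k) × (ℕ × ℕ × ℕ × ℕ →₀ k) × (ℕ × ℕ × ℕ × ℕ →₀ k)

variable {k}

open Finsupp in
/-- The value of a normal form under a substitution. -/
noncomputable def NormalForm.eval [Module k B] (s : ℕ → B) : NormalForm k →ₗ[k] B :=
  (linearCombination k s).coprod <| (linearCombination k (word₂ s s)).coprod <|
    (linearCombination k (word₃ s s s)).coprod <|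
      (linearCombination k (word₄ s s s s)).coprod (linearCombination k (word₂₂ s s s s))

variable (k)

open Finsupp FreeMagma in
/-- The normal form of a word with at most four letters (and `0` for longer words). -/
noncomputable def wordNormalForm : FreeMagma ℕ → NormalForm k
  | of i => (single i 1, 0, 0, 0, 0)
  | mul (of i) (of j) => (0, single (i, j) 1, 0, 0, 0)
  | mul (mul (of i) (of j)) (of l) => (0, 0, single (i, j, l) 1, 0, 0)
  | mul (of l) (mul (of i) (of j)) => (0, 0, single (i, j, l) 1, 0, 0)
  | mul (mul (mul (of i) (of j)) (of l)) (of m) => (0, 0, 0, single (i, j, l, m) 1, 0)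
  | mul (mul (of l) (mul (of i) (of j))) (of m) => (0, 0, 0, single (i, j, l, m) 1, 0)
  | mul (of m) (mul (mul (of i) (of j)) (of l)) => (0, 0, 0, single (i, j, l, m) 1, 0)
  | mul (of m) (mul (of l) (mul (of i) (of j))) => (0, 0, 0, single (i, j, l, m) 1, 0)
  | mul (mul (of i) (of j)) (mul (of l) (of m)) => (0, 0, 0, 0, single (i, j, l, m) 1)
  | _ => 0

theorem eval_wordNormalForm [Module k B] (s : ℕ → B) {w : FreeMagma ℕ} (hw : w.length ≤ 4) :
    (wordNormalForm k w).eval s = FreeMagma.lift s w := by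
  have := w.length_pos
  obtain h | h | h | h : w.length = 1 ∨ w.length = 2 ∨ w.length = 3 ∨ w.length = 4 := by omega
  · obtain ⟨i, rfl⟩ := length_eq_one h
    simp [wordNormalForm, NormalForm.eval]
  · obtain ⟨i, j, rfl⟩ := length_eq_two h
    simp [wordNormalForm, NormalForm.eval, word₂]
  · obtain ⟨i, j, l, rfl⟩ | ⟨i, j, l, rfl⟩ := length_eq_three h
    · simp [wordNormalForm, NormalForm.eval, word₃]
    · simp [wordNormalForm, NormalForm.eval, word₃, mul_comm (s l)]
  · obtain ⟨i, j, l, m, rfl⟩ | ⟨i, j, l, m, rfl⟩ | ⟨i, j, l, m, rfl⟩ | ⟨i, j, l, m, rfl⟩ |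
      ⟨i, j, l, m, rfl⟩ := length_eq_four h
    · simp [wordNormalForm, NormalForm.eval, word₄]
    · simp [wordNormalForm, NormalForm.eval, word₄, mul_comm (s l)]
    · simp [wordNormalForm, NormalForm.eval, word₄, mul_comm (s m)]
    · simp [wordNormalForm, NormalForm.eval, word₄, mul_comm (s m), mul_comm (s l)]
    · simp [wordNormalForm, NormalForm.eval, word₂₂]

variable {k}

/-- The normal form of a polynomial of degree at most four. -/
noncomputable def normalForm (f : NAPoly k) : NormalForm k :=
  Finsupp.linearCombination k (wordNormalForm k) f.coeff

theorem eval_normalForm [Module k B] [IsScalarTower k B B] [SMulCommClass k B B] (s : ℕ → B)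
    {f : NAPoly k} (hf : DegreeLE f 4) :
    (normalForm f).eval s = FreeNonUnitalNonAssocAlgebra.lift k s f := by
  rw [normalForm, Finsupp.linearCombination_apply, Finsupp.sum, map_sum]
  simp only [FreeNonUnitalNonAssocAlgebra.lift, Equiv.trans_apply,
    MonoidAlgebra.liftMagma_apply_apply]
  refine Finset.sum_congr rfl fun w hw => ?_
  rw [map_smul, eval_wordNormalForm k s (hf w hw)]
  rfl

end NormalForm

/-! ### Homogeneous components and isolated coefficients -/

section Vanishing

variable {k : Type u} [Field k] {A : Type v} [NonAssocCommRing A] [Module k A]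

open Finsupp in
theorem eval_homogeneous [IsScalarTower k A A] [SMulCommClass k A A]
    (h2 : (2 : k) ≠ 0) (h3 : (3 : k) ≠ 0) {N : NormalForm k} (h : ∀ s : ℕ → A, N.eval s = 0)
    (s : ℕ → A) :
    linearCombination k s N.1 = 0 ∧ linearCombination k (word₂ s s) N.2.1 = 0 ∧
    linearCombination k (word₃ s s s) N.2.2.1 = 0 ∧
    linearCombination k (word₄ s s s s) N.2.2.2.1 +
      linearCombination k (word₂₂ s s s s) N.2.2.2.2 = 0 := by
  obtain ⟨c₁, c₂, c₃, c₄, c₂₂⟩ := N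
  have key : ∀ t : k, t • linearCombination k s c₁ + t ^ 2 • linearCombination k (word₂ s s) c₂
      + t ^ 3 • linearCombination k (word₃ s s s) c₃
      + t ^ 4 • (linearCombination k (word₄ s s s s) c₄
        + linearCombination k (word₂₂ s s s s) c₂₂) = 0 := by
    intro t
    have e := h (fun i => t • s i)
    have e₂ : word₂ (fun i => t • s i) (fun i => t • s i) = fun p => t ^ 2 • word₂ s s p := by
      funext p
      simp only [word₂, smul_mul_assoc, mul_smul_comm, smul_smul, pow_succ, pow_zero, one_mul]
    have e₃ : word₃ (fun i => t • s i) (fun i => t • s i) (fun i => t • s i)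
        = fun p => t ^ 3 • word₃ s s s p := by
      funext p
      simp only [word₃, smul_mul_assoc, mul_smul_comm, smul_smul, pow_succ, pow_zero, one_mul,
        mul_assoc]
    have e₄ : word₄ (fun i => t • s i) (fun i => t • s i) (fun i => t • s i) (fun i => t • s i)
        = fun p => t ^ 4 • word₄ s s s s p := by
      funext p
      simp only [word₄, smul_mul_assoc, mul_smul_comm, smul_smul, pow_succ, pow_zero, one_mul,
        mul_assoc]
    have e₂₂ : word₂₂ (fun i => t • s i) (fun i => t • s i) (fun i => t • s i) (fun i => t • s i)
        = fun p => t ^ 4 • word₂₂ s s s s p := by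
      funext p
      simp only [word₂₂, smul_mul_assoc, mul_smul_comm, smul_smul, pow_succ, pow_zero, one_mul,
        mul_assoc]
    simp only [NormalForm.eval, LinearMap.coprod_apply, e₂, e₃, e₄, e₂₂,
      linearCombination_fun_smul] at e
    rw [← e]
    module
  generalize linearCombination k s c₁ = f₁ at *
  generalize linearCombination k (word₂ s s) c₂ = f₂ at *
  generalize linearCombination k (word₃ s s s) c₃ = f₃ at *
  generalize linearCombination k (word₄ s s s s) c₄ + linearCombination k (word₂₂ s s s s) c₂₂
    = f₄ at *
  -- Four values of the scalar suffice: the Vandermonde system at ±1, ±2 is invertible once 2 and 3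
  -- are, also over a small field.
  have k₁ := key 1
  have k₂ := key (-1)
  have k₃ := key 2
  have k₄ := key (-2)
  have h12 : (12 : k) ≠ 0 := by
    rw [show (12 : k) = 2 * 2 * 3 by norm_num]
    exact mul_ne_zero (mul_ne_zero h2 h2) h3
  have h24 : (24 : k) ≠ 0 := by
    rw [show (24 : k) = 2 * 12 by norm_num]
    exact mul_ne_zero h2 h12
  refine ⟨?_, ?_, ?_, ?_⟩
  · refine (smul_eq_zero.1 (?_ : (12 : k) • f₁ = 0)).resolve_left h12
    linear_combination (norm := module) (8 : k) • k₁ - (8 : k) • k₂ - k₃ + k₄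
  · refine (smul_eq_zero.1 (?_ : (24 : k) • f₂ = 0)).resolve_left h24
    linear_combination (norm := module) (16 : k) • k₁ + (16 : k) • k₂ - k₃ - k₄
  · refine (smul_eq_zero.1 (?_ : (12 : k) • f₃ = 0)).resolve_left h12
    linear_combination (norm := module) - (2 : k) • k₁ + (2 : k) • k₂ + k₃ - k₄
  · refine (smul_eq_zero.1 (?_ : (24 : k) • f₄ = 0)).resolve_left h24
    linear_combination (norm := module) - (4 : k) • k₁ - (4 : k) • k₂ + k₃ + k₄

open Finsupp in
-- Each position has its own substitution, supported at a single index, so exactly one word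
-- survives. The indices may coincide, so repeated variables need no separate treatment.
theorem linearCombination_word₂_single (c : ℕ × ℕ →₀ k) (i j : ℕ) (x y : A) :
    linearCombination k (word₂ (Pi.single i x) (Pi.single j y)) c = c (i, j) • (x * y) := by
  rw [show word₂ (Pi.single i x) (Pi.single j y) = Pi.single (i, j) (x * y) from ?_,
    linearCombination_single_index]
  funext p
  by_cases hp : p = (i, j)
  · subst hp; simp [word₂]
  · rw [Pi.single_eq_of_ne hp]
    simp only [Prod.ext_iff, not_and_or] at hp
    rcases hp with hp | hp <;> simp [word₂, Pi.single_eq_of_ne hp]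

open Finsupp in
theorem linearCombination_word₃_single (c : ℕ × ℕ × ℕ →₀ k) (i j l : ℕ) (x y z : A) :
    linearCombination k (word₃ (Pi.single i x) (Pi.single j y) (Pi.single l z)) c =
      c (i, j, l) • ((x * y) * z) := by
  rw [show word₃ (Pi.single i x) (Pi.single j y) (Pi.single l z) =
    Pi.single (i, j, l) ((x * y) * z) from ?_, linearCombination_single_index]
  funext p
  by_cases hp : p = (i, j, l)
  · subst hp; simp [word₃]
  · rw [Pi.single_eq_of_ne hp]
    simp only [Prod.ext_iff, not_and_or] at hp
    rcases hp with hp | hp | hp <;> simp [word₃, Pi.single_eq_of_ne hp]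

open Finsupp in
theorem linearCombination_word₄_single (c : ℕ × ℕ × ℕ × ℕ →₀ k) (i j l m : ℕ) (x y z w : A) :
    linearCombination k
        (word₄ (Pi.single i x) (Pi.single j y) (Pi.single l z) (Pi.single m w)) c =
      c (i, j, l, m) • (((x * y) * z) * w) := by
  rw [show word₄ (Pi.single i x) (Pi.single j y) (Pi.single l z) (Pi.single m w) =
    Pi.single (i, j, l, m) (((x * y) * z) * w) from ?_, linearCombination_single_index]
  funext p
  by_cases hp : p = (i, j, l, m)
  · subst hp; simp [word₄]
  · rw [Pi.single_eq_of_ne hp]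
    simp only [Prod.ext_iff, not_and_or] at hp
    rcases hp with hp | hp | hp | hp <;> simp [word₄, Pi.single_eq_of_ne hp]

open Finsupp in
theorem linearCombination_word₂₂_single (c : ℕ × ℕ × ℕ × ℕ →₀ k) (i j l m : ℕ) (x y z w : A) :
    linearCombination k
        (word₂₂ (Pi.single i x) (Pi.single j y) (Pi.single l z) (Pi.single m w)) c =
      c (i, j, l, m) • ((x * y) * (z * w)) := by
  rw [show word₂₂ (Pi.single i x) (Pi.single j y) (Pi.single l z) (Pi.single m w) =
    Pi.single (i, j, l, m) ((x * y) * (z * w)) from ?_, linearCombination_single_index]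
  funext p
  by_cases hp : p = (i, j, l, m)
  · subst hp; simp [word₂₂]
  · rw [Pi.single_eq_of_ne hp]
    simp only [Prod.ext_iff, not_and_or] at hp
    rcases hp with hp | hp | hp | hp <;> simp [word₂₂, Pi.single_eq_of_ne hp]

end Vanishing

/-! ### Coefficients that cancel under the symmetries of a word -/

section Symmetry

/-- Exchange of the first two entries. -/
def swapFirst (γ : Type*) : ℕ × ℕ × γ ≃ ℕ × ℕ × γ where
  toFun p := (p.2.1, p.1, p.2.2)
  invFun p := (p.2.1, p.1, p.2.2)
  left_inv _ := rfl
  right_inv _ := rfl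

/-- Exchange of the last two entries. -/
def swapLast : ℕ × ℕ × ℕ × ℕ ≃ ℕ × ℕ × ℕ × ℕ where
  toFun p := (p.1, p.2.1, p.2.2.2, p.2.2.1)
  invFun p := (p.1, p.2.1, p.2.2.2, p.2.2.1)
  left_inv _ := rfl
  right_inv _ := rfl

/-- Exchange of the first two entries with the last two. -/
def swapPairs : ℕ × ℕ × ℕ × ℕ ≃ ℕ × ℕ × ℕ × ℕ where
  toFun p := (p.2.2.1, p.2.2.2, p.1, p.2.1)
  invFun p := (p.2.2.1, p.2.2.2, p.1, p.2.1)
  left_inv _ := rfl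
  right_inv _ := rfl

variable {k : Type u} [Field k]

open Finsupp in
theorem linearCombination_eq_zero_of_antisymm {α : Type*} {B : Type v} [AddCommGroup B]
    [Module k B] (h2 : (2 : k) ≠ 0) {c : α →₀ k} {m : α → B} (σ : α ≃ α)
    (hm : ∀ p, m (σ p) = m p) (hc : ∀ p, c p + c (σ p) = 0) : linearCombination k m c = 0 := by
  have h := linearCombination_symmetrize c m σ hm
  rw [show c + c.equivMapDomain σ.symm = 0 from Finsupp.ext fun p => by simpa using hc p,
    map_zero] at h
  exact (smul_eq_zero.1 h.symm).resolve_left h2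

variable {B : Type v} [NonUnitalNonAssocCommRing B] [Module k B]

open Finsupp in
theorem linearCombination_word₂₂_eq_zero (h2 : (2 : k) ≠ 0) {c : ℕ × ℕ × ℕ × ℕ →₀ k}
    (hc : ∀ i j l m, c (i, j, l, m) + c (i, j, m, l) + c (j, i, l, m) + c (j, i, m, l) +
      c (l, m, i, j) + c (l, m, j, i) + c (m, l, i, j) + c (m, l, j, i) = 0) (s : ℕ → B) :
    linearCombination k (word₂₂ s s s s) c = 0 := by
  -- The three involutions generate the symmetry group of order eight of `(x_i x_j) (x_l x_m)`.
  -- Symmetrizing over each in turn produces the eight-term sum of `hc`.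
  have e₁ := linearCombination_symmetrize c (word₂₂ s s s s) (swapFirst _)
    fun p => by simp only [swapFirst, word₂₂, Equiv.coe_fn_mk, mul_comm]
  have e₂ := linearCombination_symmetrize (c + c.equivMapDomain (swapFirst _).symm)
    (word₂₂ s s s s) swapLast fun p => by
      simp only [swapLast, word₂₂, Equiv.coe_fn_mk, mul_comm]
  have e₃ := linearCombination_eq_zero_of_antisymm h2 (m := word₂₂ s s s s)
    (c := (c + c.equivMapDomain (swapFirst _).symm)
      + (c + c.equivMapDomain (swapFirst _).symm).equivMapDomain swapLast.symm)
    swapPairs (fun p => by simp only [swapPairs, word₂₂, Equiv.coe_fn_mk, mul_comm])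
    fun ⟨i, j, l, m⟩ => by
      simp only [Finsupp.add_apply, Finsupp.equivMapDomain_apply, Equiv.symm_symm, swapPairs,
        swapLast, swapFirst, Equiv.coe_fn_mk]
      linear_combination hc i j l m
  rw [e₂, e₁, smul_smul] at e₃
  exact (smul_eq_zero.1 e₃).resolve_left (mul_ne_zero h2 h2)

end Symmetry

/-! ### Symmetrized coefficients of an identity vanish -/

section Coefficients

variable {k : Type u} [Field k] {A : Type v} [NonAssocCommRing A] [Module k A]

open Finsupp in
theorem coeff_two (hA : (1 : A) ≠ 0) {c₂ : ℕ × ℕ →₀ k}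
    (h : ∀ s : ℕ → A, linearCombination k (word₂ s s) c₂ = 0) (i j : ℕ) :
    c₂ (i, j) + c₂ (j, i) = 0 := by
  have e := polarization_two (fun a b : ℕ → A => linearCombination k (word₂ a b) c₂)
    (fun a a' b =>
      linearCombination_fun_add _ fun p => by simp only [word₂, Pi.add_apply, add_mul])
    (fun a b b' =>
      linearCombination_fun_add _ fun p => by simp only [word₂, Pi.add_apply, mul_add])
    h (Pi.single i 1) (Pi.single j 1)
  simp only [linearCombination_word₂_single, mul_one, ← add_smul] at e
  exact (smul_eq_zero.1 e).resolve_right hA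

open Finsupp in
theorem coeff_three (h3 : (3 : k) ≠ 0) (hA : ¬ ∀ x y z : A, x * y * z = x * (y * z))
    {c₃ : ℕ × ℕ × ℕ →₀ k} (h : ∀ s : ℕ → A, linearCombination k (word₃ s s s) c₃ = 0)
    (i j l : ℕ) : c₃ (i, j, l) + c₃ (j, i, l) = 0 := by
  refine (degree_three_coeffs h3 hA (β := c₃ (i, l, j) + c₃ (l, i, j))
    (γ := c₃ (j, l, i) + c₃ (l, j, i)) fun x y z => ?_).1
  have e := polarization_three (fun a b c : ℕ → A => linearCombination k (word₃ a b c) c₃)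
    (fun a a' b c =>
      linearCombination_fun_add _ fun p => by simp only [word₃, Pi.add_apply, add_mul])
    (fun a b b' c =>
      linearCombination_fun_add _ fun p => by simp only [word₃, Pi.add_apply, add_mul, mul_add])
    (fun a b c c' =>
      linearCombination_fun_add _ fun p => by simp only [word₃, Pi.add_apply, mul_add])
    h (Pi.single i x) (Pi.single j y) (Pi.single l z)
  simp only [linearCombination_word₃_single] at e
  rw [mul_comm y x, mul_comm z x, mul_comm z y] at e
  rw [← e]
  module

open Finsupp in
theorem coeff_four (h3 : (3 : k) ≠ 0) (h5 : (5 : k) ≠ 0) (hτ : IsMetrized k A)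
    (hA : ¬ ∀ x y z : A, x * y * z = x * (y * z))
    (hJ : ¬ ∀ x y : A, x * ((x * x) * y) = (x * x) * (x * y))
    {c₄ c₂₂ : ℕ × ℕ × ℕ × ℕ →₀ k}
    (h : ∀ s : ℕ → A, linearCombination k (word₄ s s s s) c₄ +
      linearCombination k (word₂₂ s s s s) c₂₂ = 0) (i j l m : ℕ) :
    c₄ (i, j, l, m) + c₄ (j, i, l, m) = 0 ∧
      c₂₂ (i, j, l, m) + c₂₂ (i, j, m, l) + c₂₂ (j, i, l, m) + c₂₂ (j, i, m, l) + c₂₂ (l, m, i, j)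
          + c₂₂ (l, m, j, i) + c₂₂ (m, l, i, j) + c₂₂ (m, l, j, i) = 0 := by
  -- The 24 arrangements from polarization are grouped by commutativity: twelve left-normed words
  -- with two terms each, three products of pairs with eight each. Since `i j l m` are arbitrary,
  -- one coefficient of each kind is enough.
  refine degree_four_coeffs h3 h5 hτ hA hJ
      (a12 := c₄ (l, m, j, i) + c₄ (m, l, j, i))
      (a13 := c₄ (j, m, l, i) + c₄ (m, j, l, i))
      (a14 := c₄ (j, l, m, i) + c₄ (l, j, m, i))
      (a21 := c₄ (l, m, i, j) + c₄ (m, l, i, j))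
      (a23 := c₄ (i, m, l, j) + c₄ (m, i, l, j))
      (a24 := c₄ (i, l, m, j) + c₄ (l, i, m, j))
      (a31 := c₄ (j, m, i, l) + c₄ (m, j, i, l))
      (a32 := c₄ (i, m, j, l) + c₄ (m, i, j, l))
      (a34 := c₄ (i, j, m, l) + c₄ (j, i, m, l))
      (a41 := c₄ (j, l, i, m) + c₄ (l, j, i, m))
      (a42 := c₄ (i, l, j, m) + c₄ (l, i, j, m))
      (a43 := c₄ (i, j, l, m) + c₄ (j, i, l, m))
      (b12 := c₂₂ (i, j, l, m) + c₂₂ (i, j, m, l) + c₂₂ (j, i, l, m) + c₂₂ (j, i, m, l) + c₂₂ (l,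
      m, i, j) + c₂₂ (l, m, j, i) + c₂₂ (m, l, i, j) + c₂₂ (m, l, j, i))
      (b13 := c₂₂ (i, l, j, m) + c₂₂ (i, l, m, j) + c₂₂ (l, i, j, m) + c₂₂ (l, i, m, j) + c₂₂ (j,
      m, i, l) + c₂₂ (j, m, l, i) + c₂₂ (m, j, i, l) + c₂₂ (m, j, l, i))
      (b14 := c₂₂ (i, m, j, l) + c₂₂ (i, m, l, j) + c₂₂ (m, i, j, l) + c₂₂ (m, i, l, j) + c₂₂ (j,
      l, i, m) + c₂₂ (j, l, m, i) + c₂₂ (l, j, i, m) + c₂₂ (l, j, m, i))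
      fun x y z w => ?_
  have e := polarization_four (fun a b c d : ℕ → A =>
      linearCombination k (word₄ a b c d) c₄ + linearCombination k (word₂₂ a b c d) c₂₂)
    (fun a a' b c d => by
      rw [add_add_add_comm]
      exact congrArg₂ (· + ·)
        (linearCombination_fun_add _ fun p => by simp only [word₄, Pi.add_apply, add_mul])
        (linearCombination_fun_add _ fun p => by
          simp only [word₂₂, Pi.add_apply, add_mul]))
    (fun a b b' c d => by
      rw [add_add_add_comm]
      exact congrArg₂ (· + ·)
        (linearCombination_fun_add _ fun p => by simp only [word₄, Pi.add_apply, add_mul, mul_add])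
        (linearCombination_fun_add _ fun p => by
          simp only [word₂₂, Pi.add_apply, add_mul, mul_add]))
    (fun a b c c' d => by
      rw [add_add_add_comm]
      exact congrArg₂ (· + ·)
        (linearCombination_fun_add _ fun p => by simp only [word₄, Pi.add_apply, add_mul, mul_add])
        (linearCombination_fun_add _ fun p => by
          simp only [word₂₂, Pi.add_apply, add_mul, mul_add]))
    (fun a b c d d' => by
      rw [add_add_add_comm]
      exact congrArg₂ (· + ·)
        (linearCombination_fun_add _ fun p => by simp only [word₄, Pi.add_apply, mul_add])
        (linearCombination_fun_add _ fun p => by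
          simp only [word₂₂, Pi.add_apply, mul_add]))
    h (Pi.single i x) (Pi.single j y) (Pi.single l z) (Pi.single m w)
  simp only [linearCombination_word₄_single, linearCombination_word₂₂_single] at e
  rw [mul_comm y x, mul_comm z x, mul_comm w x, mul_comm z y, mul_comm w y, mul_comm w z,
    mul_comm (z * w) (x * y), mul_comm (y * w) (x * z), mul_comm (y * z) (x * w)] at e
  rw [← e]
  module

end Coefficients

end MetrizedAlg

open MetrizedAlg in
theorem mainTheorem10 (k : Type u) [Field k]
    (h2 : ringChar k ≠ 2) (h3 : ringChar k ≠ 3) (h5 : ringChar k ≠ 5)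
    (A : Type v) [NonAssocCommRing A] [Module k A] [IsScalarTower k A A] [SMulCommClass k A A]
    (hA : MetrizedAlg.IsMetrized k A)
    (hf : ∃ f : MetrizedAlg.NAPoly k, MetrizedAlg.DegreeLE f 4 ∧
      ¬ MetrizedAlg.ImpliedByCommutativity f ∧ MetrizedAlg.Satisfies A f) :
    (∀ x y : A, x * ((x * x) * y) = (x * x) * (x * y)) ∧
      MetrizedAlg.IsPowerAssociative k A := by
  have hchar : ∀ p : ℕ, p.Prime → ringChar k ≠ p → (p : k) ≠ 0 := fun p hp hne h0 =>
    ((Nat.dvd_prime hp).1 ((ringChar.spec k p).1 h0)).elim CharP.ringChar_ne_one hne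
  replace h2 : (2 : k) ≠ 0 := by exact_mod_cast hchar 2 Nat.prime_two h2
  replace h3 : (3 : k) ≠ 0 := by exact_mod_cast hchar 3 Nat.prime_three h3
  replace h5 : (5 : k) ≠ 0 := by exact_mod_cast hchar 5 Nat.prime_five h5
  suffices hJ : ∀ x y : A, x * ((x * x) * y) = (x * x) * (x * y) from
    ⟨hJ, isPowerAssociative_of_jordan h2 hJ⟩
  by_contra hJ
  have hassoc : ¬ ∀ x y z : A, x * y * z = x * (y * z) := fun h => hJ fun x y => by
    rw [← h, ← h, ← h, h x x x]
  have h1 := one_ne_zero_of_not_assoc hassoc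
  obtain ⟨f, hdeg, hne, hsat⟩ := hf
  have hev : ∀ s : ℕ → A, (normalForm f).eval s = 0 := fun s => by
    rw [eval_normalForm s hdeg, hsat s]
  have hhom := eval_homogeneous h2 h3 hev
  -- The coefficient conditions derived from `A` do not mention `A`, so they make the normal form
  -- vanish on any commutative `B`.
  refine hne fun B _ _ _ _ s => ?_
  rw [← eval_normalForm s hdeg]
  have hc₁ : (normalForm f).1 = 0 := Finsupp.ext fun i => by
    have := (hhom (Pi.single i 1)).1
    rw [Finsupp.linearCombination_single_index] at this
    exact (smul_eq_zero.1 this).resolve_right h1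
  have hc₂ := linearCombination_eq_zero_of_antisymm h2 (m := word₂ s s) (Equiv.prodComm ℕ ℕ)
    (fun p => mul_comm _ _) fun p => coeff_two h1 (fun s => (hhom s).2.1) p.1 p.2
  have hc₃ := linearCombination_eq_zero_of_antisymm h2 (m := word₃ s s s) (swapFirst ℕ)
    (fun p => by simp only [swapFirst, word₃, Equiv.coe_fn_mk, mul_comm])
    fun p => coeff_three h3 hassoc (fun s => (hhom s).2.2.1) p.1 p.2.1 p.2.2
  have h₄ := coeff_four h3 h5 hA hassoc hJ fun s => (hhom s).2.2.2
  have hc₄ := linearCombination_eq_zero_of_antisymm h2 (m := word₄ s s s s) (swapFirst (ℕ × ℕ))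
    (fun p => by simp only [swapFirst, word₄, Equiv.coe_fn_mk, mul_comm])
    fun p => (h₄ p.1 p.2.1 p.2.2.1 p.2.2.2).1
  have hc₂₂ := linearCombination_word₂₂_eq_zero h2 (fun i j l m => (h₄ i j l m).2) s
  simp only [NormalForm.eval, LinearMap.coprod_apply, hc₁, hc₂, hc₃, hc₄, hc₂₂, map_zero, add_zero]
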